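/- Consider $n$ parking spots $1,\dots,n$ in a row along a one-way street, and $m\le n$ cars that enter one after another. The $i$-th car has a preferred spot $\pi_i\in\{1,\dots,n\}$ and parks in the first spot $k\ge\pi_i$ that is still free, if there is one. Let $\mathrm{PF}(m,n)$ be the set of all parking functions, i.e. of all preference lists $\pi=(\pi_1,\dots,\pi_m)$ for which all cars succeed in parking, and let $\mathbb E$ denote expectation for $\pi$ uniformly distributed on $\mathrm{PF}(m,n)$. Theorem. Let $0<c<1$ be fixed and let $p,q\ge 1$ be integers. As $n\to\infty$, with $m,n$ positive integers such that $m=cn$, $$\mathbb E(\pi_1^p)=\frac{n^p}{p+1}\left(1+\frac1n\left(\frac{p+1}{2}-\frac{cp}{1-c}\right)+O\!\left(\frac1{n^2}\right)\right)$$ and $$\mathbb E(\pi_1^p\pi_2^q)=\frac{n^{p+q}}{(p+1)(q+1)}\left(1+\frac1n\left(\frac{p+q+2}{2}-\frac{c(p+q)}{1-c}\right)+O\!\left(\frac1{n^2}\right)\right).$$ The constants implied in the first and second $O$ depend only on $c,p$ and on $c,p,q$, respectively. -/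

import Mathlib

/-- `τ` is the parking outcome of the preference list `π` (`m` cars, spots `1, …, n`): the cars
enter in the order `0, 1, …, m - 1`, and car `i` parks in the first spot `k ≥ π i` of the lot
that none of the earlier cars has taken. -/
def IsParkingOutcome {m : ℕ} (n : ℕ) (π τ : Fin m → ℕ) : Prop :=
  ∀ i : Fin m,
    IsLeast {k : ℕ | k ∈ Finset.Icc 1 n ∧ π i ≤ k ∧ ∀ j : Fin m, j < i → τ j ≠ k} (τ i)

/-- `π` is a parking function with `m` cars and `n` spots: every preference is one of the spots
`1, …, n`, and all cars succeed in parking. -/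
def IsParkingFunction {m : ℕ} (n : ℕ) (π : Fin m → ℕ) : Prop :=
  (∀ i : Fin m, π i ∈ Finset.Icc 1 n) ∧ ∃ τ : Fin m → ℕ, IsParkingOutcome n π τ

open Classical in
/-- The finite set `PF(m, n)` of parking functions with `m` cars and `n` spots. -/
noncomputable def parkingFunctions (m n : ℕ) : Finset (Fin m → ℕ) :=
  (Fintype.piFinset fun _ : Fin m => Finset.Icc 1 n).filter fun π => IsParkingFunction n π

/-- The expectation of `f π` for `π` uniformly distributed on `PF(m, n)`. -/
noncomputable def parkingMean (m n : ℕ) (f : (Fin m → ℕ) → ℝ) : ℝ :=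
  (parkingFunctions m n).expect f

/-! ### Tail characterisation and enumeration of parking functions -/

section ParkingCombinatorics
open Finset

/-! Being a parking function amounts to a tail condition that ignores the order of the cars
(`parkingFunctions_eq_boundedTails`), so the first two cars can be treated as added to a list f of
all the others. One more car is refused exactly when its preference lies in an upper segment B(f) of
the spots. For two new cars with preferences j and l, the indicator of success is 1 - 1[j ∈ B] - 1[l
∈ B], up to an error supported where both j and l lie in a slightly larger segment D(f)
(`abs_two_cars_sub_le`).

Since c < 1, a Chernoff bound gives |D| a bounded second moment
(`exists_sum_card_saturatedSpots_sq_le`). Hence j ^ p can be replaced by n ^ p on B at relative cost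
O(1/n²), and only the mean of |B| matters. It is c/(1-c) + O(1/n), by the exact count
(n+1-m)(n+1)^(m-1) of parking functions (`card_boundedTails`).

In the 1/n coefficient, the power sums contribute (p+1)/2 and (q+1)/2, the refusals -(p+1)c/(1-c)
and -(q+1)c/(1-c), and the ratio of the counts for m-2 and m cars 2c/(1-c). The first formula is the
case q = 0, where the second power sum is exactly n and contributes nothing. -/

/-- The number of entries of `f` that are at least `k`. -/
def tailCount {α : Type*} [Fintype α] (f : α → ℕ) (k : ℕ) : ℕ := #{i | k ≤ f i}

open Classical in
/-- The functions with values in `{1, …, n}` of which, for every `k`, at most `n + 1 - k` entries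
are at least `k`. -/
noncomputable def boundedTails (α : Type*) [Fintype α] [DecidableEq α] (n : ℕ) : Finset (α → ℕ) :=
  (Fintype.piFinset fun _ : α => Icc 1 n).filter fun f =>
    ∀ k ∈ Icc 1 n, tailCount f k + k ≤ n + 1

theorem mem_boundedTails {α : Type*} [Fintype α] [DecidableEq α] {n : ℕ} {f : α → ℕ} :
    f ∈ boundedTails α n ↔ (∀ i, f i ∈ Icc 1 n) ∧ ∀ k ∈ Icc 1 n, tailCount f k + k ≤ n + 1 := by
  simp only [boundedTails, mem_filter, Fintype.mem_piFinset]

theorem IsParkingOutcome.injective {m n : ℕ} {π τ : Fin m → ℕ} (h : IsParkingOutcome n π τ) :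
    Function.Injective τ := by
  intro i j hij
  rcases lt_trichotomy i j with hlt | heq | hlt
  · exact absurd hij ((h j).1.2.2 i hlt)
  · exact heq
  · exact absurd hij.symm ((h i).1.2.2 j hlt)

/-- Cars preferring a spot from `k` on occupy distinct spots among `k, …, n`. -/
theorem IsParkingOutcome.tailCount_add_le {m n : ℕ} {π τ : Fin m → ℕ}
    (h : IsParkingOutcome n π τ) {k : ℕ} (hk : k ∈ Icc 1 n) : tailCount π k + k ≤ n + 1 := by
  have hle : tailCount π k ≤ #(Icc k n) := by
    refine card_le_card_of_injOn τ (fun i hi => ?_) h.injective.injOn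
    have hi' : k ≤ π i := by simpa using hi
    exact mem_coe.2 (mem_Icc.2 ⟨hi'.trans (h i).1.2.1, (mem_Icc.1 (h i).1.1).2⟩)
  rw [Nat.card_Icc] at hle
  rw [mem_Icc] at hk
  omega

/-- If the spots from `b` on are all taken, then for some `a ≤ b` the spots from `a` on are all
taken, by cars that prefer one of them. -/
theorem IsParkingOutcome.exists_le_tailCount {m n : ℕ} {π τ : Fin m → ℕ}
    (h : IsParkingOutcome n π τ) (hπ : ∀ i, 1 ≤ π i) {b : ℕ} (hb : b ∈ Icc 1 n)
    (hfull : ∀ k, b ≤ k → k ≤ n → ∃ i, τ i = k) :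
    ∃ a ∈ Icc 1 n, a ≤ b ∧ n + 1 ≤ tailCount π a + a := by
  rw [mem_Icc] at hb
  classical
  have hex : ∃ a, 1 ≤ a ∧ a ≤ b ∧ ∀ k, a ≤ k → k ≤ n → ∃ i, τ i = k := ⟨b, hb.1, le_rfl, hfull⟩
  obtain ⟨ha1, hab, hafull⟩ := Nat.find_spec hex
  have hmin := fun c (hc : c < Nat.find hex) => Nat.find_min hex hc
  generalize Nat.find hex = a at *
  refine ⟨a, mem_Icc.2 ⟨ha1, hab.trans hb.2⟩, hab, ?_⟩
  have hle : #(Icc a n) ≤ tailCount π a := by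
    have hsub : Icc a n ⊆ ({i | a ≤ π i} : Finset (Fin m)).image τ := by
      intro k hk
      rw [mem_Icc] at hk
      obtain ⟨i, hi⟩ := hafull k hk.1 hk.2
      refine mem_image.2 ⟨i, ?_, hi⟩
      simp only [mem_filter, mem_univ, true_and]
      by_contra! hlt
      have hi1 := hπ i
      -- By minimality of `a`, spot `a - 1` stays empty; a car preferring a spot below `a` would
      -- have stopped there at the latest.
      have hempty : ∀ j, τ j ≠ a - 1 := by
        intro j hj
        refine hmin (a - 1) (by omega) ⟨by omega, by omega, fun k' hk' hk'n => ?_⟩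
        rcases Nat.lt_or_ge k' a with hlt' | hge
        · exact ⟨j, by omega⟩
        · exact hafull k' hge hk'n
      have := (h i).2 (show a - 1 ∈ _ from
        ⟨mem_Icc.2 ⟨by omega, by omega⟩, by omega, fun j _ => hempty j⟩)
      omega
    exact (card_le_card hsub).trans card_image_le
  rw [Nat.card_Icc] at hle
  omega

theorem exists_isParkingOutcome {m n : ℕ} {π : Fin m → ℕ} (hπ : ∀ i, π i ∈ Icc 1 n)
    (hT : ∀ k ∈ Icc 1 n, tailCount π k + k ≤ n + 1) : ∃ τ, IsParkingOutcome n π τ := by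
  induction m with
  | zero => exact ⟨fun _ => 0, fun i => i.elim0⟩
  | succ m ih =>
    have hcount : ∀ k, tailCount π k = tailCount (fun i : Fin m => π i.castSucc) k +
        if k ≤ π (Fin.last m) then 1 else 0 := by
      intro k
      simp only [tailCount, card_filter]
      rw [Fin.sum_univ_castSucc]
    obtain ⟨τ, hτ⟩ := ih (π := fun i => π i.castSucc) (fun i => hπ _) (fun k hk => by
      have := hT k hk
      rw [hcount] at this
      omega)
    -- If the last car were blocked, the earlier cars would already exhaust some tail from `a ≤ π
    -- (Fin.last m)`, and the last car would overfill it.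
    have hne : ({k : ℕ | k ∈ Icc 1 n ∧ π (Fin.last m) ≤ k ∧ ∀ j : Fin m, τ j ≠ k}).Nonempty := by
      by_contra hemp
      rw [Set.not_nonempty_iff_eq_empty, Set.eq_empty_iff_forall_notMem] at hemp
      have hl := hπ (Fin.last m)
      obtain ⟨a, ha, hab, hle⟩ := hτ.exists_le_tailCount (fun i => (mem_Icc.1 (hπ _)).1) hl
        (fun k hk hkn => by
          by_contra! hne
          exact hemp k ⟨mem_Icc.2 ⟨(mem_Icc.1 hl).1.trans hk, hkn⟩, hk, hne⟩)
      have := hT a ha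
      rw [hcount, if_pos hab] at this
      omega
    refine ⟨Fin.snoc τ (sInf {k : ℕ | k ∈ Icc 1 n ∧ π (Fin.last m) ≤ k ∧ ∀ j : Fin m, τ j ≠ k}),
      fun i => ?_⟩
    induction i using Fin.lastCases with
    | last =>
      rw [Fin.snoc_last]
      have hl : IsLeast {k : ℕ | k ∈ Icc 1 n ∧ π (Fin.last m) ≤ k ∧ ∀ j : Fin m, τ j ≠ k}
          (sInf {k : ℕ | k ∈ Icc 1 n ∧ π (Fin.last m) ≤ k ∧ ∀ j : Fin m, τ j ≠ k}) :=
        ⟨Nat.sInf_mem hne, fun k hk => Nat.sInf_le hk⟩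
      convert hl using 3 with k
      refine and_congr_right fun _ => and_congr_right fun _ => ⟨fun H j => ?_, fun H j hj => ?_⟩
      · simpa using H j.castSucc (Fin.castSucc_lt_last j)
      · obtain ⟨j, rfl⟩ := Fin.exists_castSucc_eq.2 hj.ne
        simpa using H j
    | cast i =>
      rw [Fin.snoc_castSucc]
      convert hτ i using 3 with k
      refine and_congr_right fun _ => and_congr_right fun _ => ⟨fun H j hj => ?_, fun H j hj => ?_⟩
      · simpa using H j.castSucc (by simpa using hj)
      · obtain ⟨j, rfl⟩ := Fin.exists_castSucc_eq.2 (hj.trans (Fin.castSucc_lt_last i)).ne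
        simpa using H j (by simpa using hj)

theorem parkingFunctions_eq_boundedTails (m n : ℕ) :
    parkingFunctions m n = boundedTails (Fin m) n := by
  ext π
  classical
  rw [parkingFunctions, mem_filter, Fintype.mem_piFinset, mem_boundedTails]
  constructor
  · rintro ⟨hπ, -, τ, hτ⟩
    exact ⟨hπ, fun k hk => hτ.tailCount_add_le hk⟩
  · rintro ⟨hπ, hT⟩
    exact ⟨hπ, hπ, exists_isParkingOutcome hπ hT⟩

/-- Deleting the entries equal to 1 and lowering the others by 1 shifts every tail condition by one.
The condition at `k = 1` is the bound on the cardinality of `α`. -/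
theorem card_boundedTails_fiber {α : Type*} [Fintype α] [DecidableEq α] {n : ℕ}
    (hα : Fintype.card α ≤ n + 1) (S : Finset α) :
    #{f ∈ boundedTails α (n + 1) | ({i | 1 < f i} : Finset α) = S} = #(boundedTails S n) := by
  have key : ∀ (f : α → ℕ) (g : S → ℕ), (∀ i : S, f i = g i + 1) → (∀ i ∉ S, f i = 1) →
      ∀ k, 1 ≤ k → tailCount f (k + 1) = tailCount g k := by
    intro f g h1 h2 k hk
    unfold tailCount
    rw [← card_map (Function.Embedding.subtype (· ∈ S)) (s := ({i | k ≤ g i} : Finset S))]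
    congr 1
    ext i
    simp only [mem_filter, mem_univ, true_and, mem_map, Function.Embedding.subtype_apply,
      Subtype.exists, exists_and_right, exists_eq_right]
    by_cases hi : i ∈ S
    · have := h1 ⟨i, hi⟩
      simp only at this
      simp [hi, this]
    · simp only [h2 i hi, hi, IsEmpty.exists_iff, iff_false]
      omega
  refine card_nbij' (fun f i => f i - 1) (fun g i => if h : i ∈ S then g ⟨i, h⟩ + 1 else 1)
    ?_ ?_ ?_ ?_
  · intro f hf
    simp only [coe_filter, mem_boundedTails, Set.mem_ofPred_eq, mem_coe, mem_Icc] at hf ⊢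
    obtain ⟨⟨hf1, hf2⟩, rfl⟩ := hf
    have hlt : ∀ i : ({i | 1 < f i} : Finset α), 1 < f i := fun i => (mem_filter.1 i.2).2
    refine ⟨fun i => ?_, fun k hk => ?_⟩
    · have := hlt i
      have := hf1 i
      omega
    · rw [← key f _ (fun i => by have := hlt i; omega) (fun i hi => by
        have := hf1 i
        simp only [mem_filter, mem_univ, true_and] at hi
        omega) k hk.1]
      have := hf2 (k + 1) (by omega)
      omega
  · intro g hg
    simp only [coe_filter, mem_boundedTails, Set.mem_ofPred_eq, mem_coe, mem_Icc] at hg ⊢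
    obtain ⟨hg1, hg2⟩ := hg
    refine ⟨⟨fun i => ?_, fun k hk => ?_⟩, ?_⟩
    · split_ifs with h
      · have := hg1 ⟨i, h⟩
        omega
      · omega
    · obtain rfl | ⟨k, rfl, hk1⟩ : k = 1 ∨ ∃ l, k = l + 1 ∧ 1 ≤ l :=
        (Nat.eq_or_lt_of_le hk.1).imp Eq.symm fun h => ⟨k - 1, by omega, by omega⟩
      · have : tailCount (fun i => if h : i ∈ S then g ⟨i, h⟩ + 1 else 1) 1 ≤ Fintype.card α :=
          card_le_univ _
        omega
      · rw [key _ g (fun i => by simp) (fun i hi => by simp [hi]) k hk1]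
        have := hg2 k (by omega)
        omega
    · ext i
      by_cases h : i ∈ S
      · have := hg1 ⟨i, h⟩
        simp [h]
        omega
      · simp [h]
  · intro f hf
    simp only [coe_filter, mem_boundedTails, Set.mem_ofPred_eq, mem_Icc] at hf
    obtain ⟨⟨hf1, -⟩, rfl⟩ := hf
    funext i
    have := hf1 i
    by_cases h : 1 < f i
    · simp [h]
      omega
    · simp [h]
      omega
  · intro g hg
    funext i
    simp

theorem sum_card_mul_pow_card (α : Type*) [Fintype α] (x : ℝ) :
    (∑ S : Finset α, (#S : ℝ) * x ^ #S) * (x + 1) =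
      Fintype.card α * x * (x + 1) ^ Fintype.card α := by
  rw [← powerset_univ, sum_powerset_apply_card (fun s => (s : ℝ) * x ^ s), card_univ]
  cases Fintype.card α with
  | zero => simp
  | succ m =>
    rw [sum_range_succ', pow_succ]
    have : ∀ s ∈ range (m + 1), (m + 1).choose (s + 1) • (((s + 1 : ℕ) : ℝ) * x ^ (s + 1)) =
        (m + 1) * x * (x ^ s * m.choose s) := by
      intro s _
      have h : ((m : ℝ) + 1) * m.choose s = (m + 1).choose (s + 1) * (s + 1) := by
        exact_mod_cast Nat.add_one_mul_choose_eq m s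
      rw [nsmul_eq_mul, pow_succ]
      push_cast
      linear_combination (-x * x ^ s) * h
    rw [sum_congr rfl this, ← mul_sum]
    have h2 : (x + 1) ^ m = ∑ s ∈ range (m + 1), x ^ s * m.choose s := by
      simp [add_pow]
    rw [← h2]
    push_cast
    simp
    ring

/-- Induction on `n`, splitting by the set `S` of entries exceeding 1 and summing with the binomial
theorem. The factor `n + 1` on the left avoids the exponent `card α - 1`. The boundary case `card α
= n + 1`, where both sides vanish, is needed in the induction for `S = univ`. -/
theorem card_boundedTails (n : ℕ) (α : Type*) [Fintype α] [DecidableEq α]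
    (hα : Fintype.card α ≤ n + 1) :
    (#(boundedTails α n) : ℝ) * (n + 1) =
      (n + 1 - Fintype.card α) * (n + 1) ^ Fintype.card α := by
  induction n generalizing α with
  | zero =>
    rcases isEmpty_or_nonempty α with hE | hE
    · have : boundedTails α 0 = univ := by
        ext f
        simp [mem_boundedTails, -univ_unique]
      simp [this]
    · have hc : Fintype.card α = 1 := le_antisymm (by simpa using hα) Fintype.card_pos
      have : boundedTails α 0 = ∅ := by
        ext f
        simp [mem_boundedTails]
      simp [this, hc]
  | succ n ih =>
    rcases Nat.lt_or_ge (n + 1) (Fintype.card α) with hlt | hle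
    · have hc : Fintype.card α = n + 2 := by omega
      have : boundedTails α (n + 1) = ∅ := by
        refine eq_empty_of_forall_notMem fun f hf => ?_
        rw [mem_boundedTails] at hf
        have h1 := hf.2 1 (by simp)
        have h2 : tailCount f 1 = Fintype.card α := by
          unfold tailCount
          rw [filter_true_of_mem (fun i _ => (mem_Icc.1 (hf.1 i)).1), card_univ]
        omega
      simp [this, hc]
      left
      ring
    · have hsum : (#(boundedTails α (n + 1)) : ℝ) * (n + 1) =
          ∑ S : Finset α, ((n + 1 - #S) * (n + 1) ^ #S : ℝ) := by
        rw [card_eq_sum_card_fiberwise (f := fun f => ({i | 1 < f i} : Finset α)) (t := univ)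
          (fun _ _ => by simp)]
        push_cast
        rw [sum_mul]
        refine sum_congr rfl fun S _ => ?_
        rw [card_boundedTails_fiber hle, ih S (by
          simpa using (card_le_univ S).trans hle)]
        simp
      have h1 := sum_card_mul_pow_card α ((n : ℝ) + 1)
      have h2 := Fintype.sum_pow_mul_eq_add_pow α ((n : ℝ) + 1) 1
      simp only [one_pow, mul_one] at h2
      simp only [sub_mul, sum_sub_distrib, ← mul_sum] at hsum
      rw [h2] at hsum
      have hn : (n : ℝ) + 1 ≠ 0 := by positivity
      apply mul_right_cancel₀ hn
      push_cast
      linear_combination ((n : ℝ) + 1 + 1) * hsum - h1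

end ParkingCombinatorics

/-! ### Adding cars, and the size of the set of refused preferences -/

section TailEstimates
open Finset

open Classical in
/-- The spots `j ∈ {1, …, n}` such that some `k ∈ {1, …, j}` has `s ≤ tailCount f k + k`. For
`s = n + 1` these are the preferences with which one more car would fail to park. -/
noncomputable def saturatedSpots {α : Type*} [Fintype α] (s n : ℕ) (f : α → ℕ) : Finset ℕ :=
  (Icc 1 n).filter fun j => ∃ k ∈ Icc 1 j, s ≤ tailCount f k + k

theorem mem_saturatedSpots {α : Type*} [Fintype α] {s n j : ℕ} {f : α → ℕ} :
    j ∈ saturatedSpots s n f ↔ j ∈ Icc 1 n ∧ ∃ k ∈ Icc 1 j, s ≤ tailCount f k + k :=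
  @mem_filter _ _ (_) _ _

theorem saturatedSpots_subset_Icc {α : Type*} [Fintype α] (s n : ℕ) (f : α → ℕ) :
    saturatedSpots s n f ⊆ Icc 1 n :=
  fun _ hj => (mem_saturatedSpots.1 hj).1

theorem saturatedSpots_anti {α : Type*} [Fintype α] {s s' : ℕ} (h : s ≤ s') (n : ℕ) (f : α → ℕ) :
    saturatedSpots s' n f ⊆ saturatedSpots s n f := by
  intro j hj
  rw [mem_saturatedSpots] at hj ⊢
  obtain ⟨hj, k, hk, hle⟩ := hj
  exact ⟨hj, k, hk, h.trans hle⟩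

theorem sub_le_card_saturatedSpots {α : Type*} [Fintype α] {s n j : ℕ} {f : α → ℕ}
    (hj : j ∈ saturatedSpots s n f) : n - j ≤ #(saturatedSpots s n f) := by
  rw [mem_saturatedSpots] at hj
  obtain ⟨hj, k, hk, hle⟩ := hj
  have hsub : Icc j n ⊆ saturatedSpots s n f := by
    intro i hi
    rw [mem_Icc] at hi hj hk
    exact mem_saturatedSpots.2 ⟨mem_Icc.2 ⟨hj.1.trans hi.1, hi.2⟩, k,
      mem_Icc.2 ⟨hk.1, hk.2.trans hi.1⟩, hle⟩
  have := card_le_card hsub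
  rw [Nat.card_Icc] at this
  omega

theorem tailCount_cons {m : ℕ} (j : ℕ) (f : Fin m → ℕ) (k : ℕ) :
    tailCount (Fin.cons j f : Fin (m + 1) → ℕ) k = (if k ≤ j then 1 else 0) + tailCount f k := by
  simp only [tailCount, card_filter]
  rw [Fin.sum_univ_succ]
  simp

/-- The new entry `j` raises exactly the tails with `k ≤ j`, so it is refused when one of these is
already full. -/
theorem cons_mem_boundedTails {m n j : ℕ} {f : Fin m → ℕ} :
    (Fin.cons j f : Fin (m + 1) → ℕ) ∈ boundedTails (Fin (m + 1)) n ↔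
      f ∈ boundedTails (Fin m) n ∧ j ∈ Icc 1 n ∧ j ∉ saturatedSpots (n + 1) n f := by
  simp only [mem_boundedTails, Fin.forall_fin_succ, Fin.cons_zero, Fin.cons_succ, tailCount_cons,
    mem_saturatedSpots, mem_Icc]
  constructor
  · rintro ⟨⟨hj, hf⟩, hT⟩
    refine ⟨⟨hf, fun k hk => ?_⟩, hj, ?_⟩
    · have := hT k hk
      omega
    · rintro ⟨-, k, hk, hle⟩
      have := hT k ⟨hk.1, hk.2.trans hj.2⟩
      rw [if_pos hk.2] at this
      omega
  · rintro ⟨⟨hf, hT⟩, hj, hn⟩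
    refine ⟨⟨hj, hf⟩, fun k hk => ?_⟩
    have := hT k hk
    split_ifs with h
    · by_contra hlt
      exact hn ⟨hj, k, ⟨hk.1, h⟩, by omega⟩
    · omega

theorem sum_boundedTails_succ (m n : ℕ) (F : (Fin (m + 1) → ℕ) → ℝ) :
    ∑ π ∈ boundedTails (Fin (m + 1)) n, F π = ∑ f ∈ boundedTails (Fin m) n,
      ∑ j ∈ Icc 1 n, if j ∈ saturatedSpots (n + 1) n f then 0 else F (Fin.cons j f) := by
  have h : ∀ f : Fin m → ℕ,
      (∑ j ∈ Icc 1 n, if j ∈ saturatedSpots (n + 1) n f then 0 else F (Fin.cons j f)) =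
        ∑ j ∈ Icc 1 n \ saturatedSpots (n + 1) n f, F (Fin.cons j f) := by
    intro f
    rw [sdiff_eq_filter, sum_filter]
    exact sum_congr rfl fun j _ => (ite_not _ _ _).symm
  simp only [h]
  rw [sum_sigma']
  refine sum_nbij' (fun π => ⟨Fin.tail π, π 0⟩) (fun x => Fin.cons x.2 x.1) ?_ ?_ ?_ ?_ ?_
  · intro π hπ
    rw [← Fin.cons_self_tail π, cons_mem_boundedTails] at hπ
    simpa using hπ
  · rintro ⟨f, j⟩ hx
    rw [cons_mem_boundedTails]
    simpa using hx
  · intro π _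
    simp
  · rintro ⟨f, j⟩ _
    simp
  · intro π _
    simp

/-- Double counting of the refused pairs `(f, j)`; with `card_boundedTails` it gives the mean number
of refused spots exactly. -/
theorem sum_card_saturatedSpots (m n : ℕ) :
    ∑ f ∈ boundedTails (Fin m) n, (#(saturatedSpots (n + 1) n f) : ℝ) =
      n * #(boundedTails (Fin m) n) - #(boundedTails (Fin (m + 1)) n) := by
  have h := sum_boundedTails_succ m n (fun _ => 1)
  have h2 : ∀ f : Fin m → ℕ, (∑ j ∈ Icc 1 n,
      if j ∈ saturatedSpots (n + 1) n f then (0 : ℝ) else 1) =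
        n - #(saturatedSpots (n + 1) n f) := by
    intro f
    have : ∀ j, (if j ∈ saturatedSpots (n + 1) n f then (0 : ℝ) else 1) =
        1 - if j ∈ saturatedSpots (n + 1) n f then 1 else 0 := by
      intro j
      split_ifs <;> simp
    simp only [this, sum_sub_distrib]
    rw [sum_ite_mem, inter_eq_right.2 (saturatedSpots_subset_Icc _ _ _)]
    simp
  simp only [h2, sum_sub_distrib] at h
  simp only [sum_const, nsmul_eq_mul, mul_one] at h
  linarith

/-- Inclusion–exclusion for two additional cars. -/
theorem abs_two_cars_sub_le {m n j l : ℕ} {f : Fin m → ℕ} (hj : j ∈ Icc 1 n) (hl : l ∈ Icc 1 n) :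
    |(if l ∈ saturatedSpots (n + 1) n f then (0 : ℝ) else
        if j ∈ saturatedSpots (n + 1) n (Fin.cons l f : Fin (m + 1) → ℕ) then 0 else 1) -
      (1 - (if j ∈ saturatedSpots (n + 1) n f then 1 else 0) -
        (if l ∈ saturatedSpots (n + 1) n f then 1 else 0))| ≤
      (if j ∈ saturatedSpots n n f then 1 else 0) *
        (if l ∈ saturatedSpots n n f then 1 else 0) := by
  have hsub := saturatedSpots_anti (Nat.le_succ n) n f
  have hcons : j ∈ saturatedSpots (n + 1) n f →
      j ∈ saturatedSpots (n + 1) n (Fin.cons l f : Fin (m + 1) → ℕ) := by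
    rw [mem_saturatedSpots, mem_saturatedSpots]
    rintro ⟨hj, k, hk, hle⟩
    refine ⟨hj, k, hk, ?_⟩
    rw [tailCount_cons]
    omega
  -- If the car at `l` newly blocks `j`, the full tail starts at some `k ≤ j, l` and was one short
  -- of full before; hence the threshold `n`.
  have hjoint : j ∈ saturatedSpots (n + 1) n (Fin.cons l f : Fin (m + 1) → ℕ) →
      j ∈ saturatedSpots (n + 1) n f ∨ j ∈ saturatedSpots n n f ∧ l ∈ saturatedSpots n n f := by
    simp only [mem_saturatedSpots, tailCount_cons]
    rintro ⟨-, k, hk, hle⟩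
    rw [mem_Icc] at hk
    split_ifs at hle with h
    · exact Or.inr ⟨⟨hj, k, mem_Icc.2 hk, by omega⟩, hl, k, mem_Icc.2 ⟨hk.1, h⟩, by omega⟩
    · exact Or.inl ⟨hj, k, mem_Icc.2 hk, by omega⟩
  by_cases h1 : l ∈ saturatedSpots (n + 1) n f
  · by_cases h2 : j ∈ saturatedSpots (n + 1) n f
    · simp [h1, h2, hsub h1, hsub h2]
    · rw [if_pos h1, if_pos h1, if_neg h2]
      split_ifs <;> norm_num
  · by_cases h2 : j ∈ saturatedSpots (n + 1) n f
    · rw [if_neg h1, if_pos (hcons h2), if_pos h2, if_neg h1]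
      split_ifs <;> norm_num
    · rw [if_neg h1, if_neg h1, if_neg h2]
      by_cases h3 : j ∈ saturatedSpots (n + 1) n (Fin.cons l f : Fin (m + 1) → ℕ)
      · obtain h | ⟨h4, h5⟩ := hjoint h3
        · exact absurd h h2
        · simp [h3, h4, h5]
      · rw [if_neg h3]
        split_ifs <;> norm_num

/-- The least saturated spot has a witness `k`, and all saturated spots lie in `k, …, n`. The single
term `t = n + 1 - k` already dominates. -/
theorem card_saturatedSpots_sq_le {α : Type*} [Fintype α] (n : ℕ) (f : α → ℕ) :
    (#(saturatedSpots n n f) : ℝ) ^ 2 ≤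
      ∑ t ∈ Icc 1 n, if t ≤ tailCount f (n + 1 - t) + 1 then (t : ℝ) ^ 2 else 0 := by
  have hnn : ∀ t ∈ Icc 1 n,
      (0 : ℝ) ≤ if t ≤ tailCount f (n + 1 - t) + 1 then (t : ℝ) ^ 2 else 0 := by
    intro t _
    split_ifs <;> positivity
  rcases (saturatedSpots n n f).eq_empty_or_nonempty with h0 | h0
  · rw [h0]
    simpa using sum_nonneg hnn
  · obtain ⟨hj, k, hk, hle⟩ := mem_saturatedSpots.1 (min'_mem _ h0)
    have hmin : ∀ i ∈ saturatedSpots n n f, (saturatedSpots n n f).min' h0 ≤ i :=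
      fun i hi => min'_le _ i hi
    generalize (saturatedSpots n n f).min' h0 = j at *
    rw [mem_Icc] at hj hk
    have hcard : #(saturatedSpots n n f) ≤ n + 1 - k := by
      rw [← Nat.card_Icc]
      refine card_le_card fun i hi => mem_Icc.2 ⟨hk.2.trans (hmin i hi), ?_⟩
      exact (mem_Icc.1 (saturatedSpots_subset_Icc _ _ _ hi)).2
    have hs := single_le_sum hnn (mem_Icc.2 (by omega : 1 ≤ n + 1 - k ∧ n + 1 - k ≤ n))
    rw [if_pos (by rw [Nat.sub_sub_self (by omega)]; omega)] at hs
    refine le_trans ?_ hs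
    gcongr

/-- An exponential moment bound for the number of functions with a heavy tail. -/
theorem card_heavy_tail_mul_pow_le {m n t : ℕ} (ht : t ∈ Icc 1 n) {x : ℝ} (hx : 1 ≤ x) :
    (#{f ∈ Fintype.piFinset fun _ : Fin m => Icc 1 n | t ≤ tailCount f (n + 1 - t) + 1} : ℝ) *
      x ^ t ≤ x * (n + t * (x - 1)) ^ m := by
  rw [mem_Icc] at ht
  have hsum : ∑ v ∈ Icc 1 n, (if n + 1 - t ≤ v then x else 1) = n + t * (x - 1) := by
    have : ∀ v, (if n + 1 - t ≤ v then x else 1) = 1 + if n + 1 - t ≤ v then x - 1 else 0 := by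
      intro v
      split_ifs <;> ring
    simp only [this, sum_add_distrib]
    rw [← sum_filter]
    have h2 : (Icc 1 n).filter (fun v => n + 1 - t ≤ v) = Icc (n + 1 - t) n := by
      ext v
      simp only [mem_filter, mem_Icc]
      omega
    rw [h2, sum_const, sum_const, Nat.card_Icc, Nat.card_Icc, Nat.sub_sub_self (by omega)]
    simp
  -- The generating function of `tailCount` factors over the independent entries; Markov's
  -- inequality for `x ^ tailCount` follows.
  have hprod := prod_univ_sum (fun _ : Fin m => Icc 1 n)
    (fun _ v => if n + 1 - t ≤ v then x else 1)
  simp only [hsum, prod_const, card_univ, Fintype.card_fin] at hprod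
  have hT : ∀ f : Fin m → ℕ, ∏ i, (if n + 1 - t ≤ f i then x else 1) =
      x ^ tailCount f (n + 1 - t) := by
    intro f
    rw [prod_ite, prod_const, prod_const_one, mul_one, tailCount]
  simp only [hT] at hprod
  rw [hprod, mul_sum, ← nsmul_eq_mul, ← sum_const, sum_filter]
  refine sum_le_sum fun f _ => ?_
  split_ifs with h
  · rw [← pow_succ']
    exact pow_le_pow_right₀ hx h
  · positivity

theorem add_mul_pow_le {m n t : ℕ} {c x : ℝ} (hx : 1 ≤ x) (hn : 1 ≤ n) (hm : (m : ℝ) ≤ c * n) :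
    (n + t * (x - 1) : ℝ) ^ m ≤ n ^ m * Real.exp (c * (x - 1)) ^ t := by
  have hn' : (0 : ℝ) < n := by exact_mod_cast hn
  have hx' : 0 ≤ x - 1 := by linarith
  have h1 : (n + t * (x - 1) : ℝ) ≤ n * Real.exp (t * (x - 1) / n) := by
    have := Real.add_one_le_exp (t * (x - 1) / n)
    calc (n + t * (x - 1) : ℝ) = n * (t * (x - 1) / n + 1) := by field_simp; ring
      _ ≤ _ := by gcongr
  calc (n + t * (x - 1) : ℝ) ^ m ≤ (n * Real.exp (t * (x - 1) / n)) ^ m := by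
        gcongr
    _ = n ^ m * Real.exp (m * (t * (x - 1) / n)) := by
        rw [mul_pow, ← Real.exp_nat_mul]
    _ ≤ n ^ m * Real.exp (t * (c * (x - 1))) := by
        have h : (m : ℝ) * (t * (x - 1) / n) ≤ t * (c * (x - 1)) :=
          calc (m : ℝ) * (t * (x - 1) / n) ≤ (c * n) * (t * (x - 1) / n) := by gcongr
            _ = t * (c * (x - 1)) := by field_simp
        exact mul_le_mul_of_nonneg_left (Real.exp_le_exp.2 h) (by positivity)
    _ = _ := by rw [← Real.exp_nat_mul]

/-- The second moment of the number of nearly saturated spots is bounded. -/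
theorem exists_sum_card_saturatedSpots_sq_le {c : ℝ} (hc0 : 0 < c) (hc1 : c < 1) :
    ∃ K : ℝ, 0 ≤ K ∧ ∀ m n : ℕ, (m : ℝ) ≤ c * n →
      ∑ f ∈ boundedTails (Fin m) n, (#(saturatedSpots n n f) : ℝ) ^ 2 ≤ K * n ^ m := by
  -- The Chernoff bound has ratio `exp (c * (x - 1)) / x`, minimised at `x = c⁻¹` with value `ρ`,
  -- which is below 1 because `c ≠ 1`.
  set ρ : ℝ := c * Real.exp (1 - c) with hρ
  have hρ0 : 0 ≤ ρ := by positivity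
  have hρ1 : ρ < 1 := by
    have h1 : c < Real.exp (c - 1) := by
      have := Real.add_one_lt_exp (x := c - 1) (by linarith)
      linarith
    calc ρ < Real.exp (c - 1) * Real.exp (1 - c) := by rw [hρ]; gcongr
      _ = 1 := by rw [← Real.exp_add]; simp
  have hs : Summable fun t : ℕ => (t : ℝ) ^ 2 * ρ ^ t :=
    summable_pow_mul_geometric_of_norm_lt_one 2 (by rwa [Real.norm_of_nonneg hρ0])
  refine ⟨c⁻¹ * ∑' t : ℕ, (t : ℝ) ^ 2 * ρ ^ t, by positivity, fun m n hm => ?_⟩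
  have hx : 1 ≤ c⁻¹ := (one_le_inv₀ hc0).2 hc1.le
  have hcard : ∀ t ∈ Icc 1 n,
      (#{f ∈ Fintype.piFinset fun _ : Fin m => Icc 1 n |
        t ≤ tailCount f (n + 1 - t) + 1} : ℝ) ≤ c⁻¹ * n ^ m * ρ ^ t := by
    intro t ht
    have hn : 1 ≤ n := by
      rw [mem_Icc] at ht
      omega
    have h1 := (card_heavy_tail_mul_pow_le (m := m) ht hx).trans
      (mul_le_mul_of_nonneg_left (add_mul_pow_le hx hn hm) (by positivity))
    have h2 : c * (c⁻¹ - 1) = 1 - c := by field_simp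
    rw [h2, inv_pow, ← div_eq_mul_inv, div_le_iff₀ (by positivity)] at h1
    calc _ ≤ _ := h1
      _ = _ := by rw [hρ, mul_pow]; ring
  calc ∑ f ∈ boundedTails (Fin m) n, (#(saturatedSpots n n f) : ℝ) ^ 2
      ≤ ∑ f ∈ Fintype.piFinset fun _ : Fin m => Icc 1 n,
          (#(saturatedSpots n n f) : ℝ) ^ 2 :=
        sum_le_sum_of_subset_of_nonneg
          (fun f hf => Fintype.mem_piFinset.2 (mem_boundedTails.1 hf).1) fun _ _ _ => by positivity
    _ ≤ ∑ f ∈ Fintype.piFinset fun _ : Fin m => Icc 1 n,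
          ∑ t ∈ Icc 1 n, if t ≤ tailCount f (n + 1 - t) + 1 then (t : ℝ) ^ 2 else 0 :=
        sum_le_sum fun f _ => card_saturatedSpots_sq_le n f
    _ = ∑ t ∈ Icc 1 n, (t : ℝ) ^ 2 * #{f ∈ Fintype.piFinset fun _ : Fin m => Icc 1 n |
          t ≤ tailCount f (n + 1 - t) + 1} := by
        rw [sum_comm]
        refine sum_congr rfl fun t _ => ?_
        rw [← sum_filter, sum_const, nsmul_eq_mul, mul_comm]
    _ ≤ ∑ t ∈ Icc 1 n, (t : ℝ) ^ 2 * (c⁻¹ * n ^ m * ρ ^ t) :=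
        sum_le_sum fun t ht => mul_le_mul_of_nonneg_left (hcard t ht) (by positivity)
    _ = c⁻¹ * (∑ t ∈ Icc 1 n, (t : ℝ) ^ 2 * ρ ^ t) * n ^ m := by
        rw [mul_sum, sum_mul]
        exact sum_congr rfl fun t _ => by ring
    _ ≤ c⁻¹ * (∑' t : ℕ, (t : ℝ) ^ 2 * ρ ^ t) * n ^ m := by
        gcongr
        exact hs.sum_le_tsum _ fun t _ => by positivity

end TailEstimates

/-! ### Moment sums in terms of the counts of parking functions -/

section Moments
open Finset

theorem mul_pow_sub_pow_le {x y : ℝ} (hy : 0 ≤ y) (hxy : y ≤ x) (p : ℕ) :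
    x * (x ^ p - y ^ p) ≤ p * x ^ p * (x - y) := by
  induction p with
  | zero => simp
  | succ p ih =>
    have h1 : y ^ p ≤ x ^ p := pow_le_pow_left₀ hy hxy p
    have hx : 0 ≤ x := hy.trans hxy
    calc x * (x ^ (p + 1) - y ^ (p + 1)) = x * (x * (x ^ p - y ^ p)) + x * y ^ p * (x - y) := by
          ring
      _ ≤ x * (p * x ^ p * (x - y)) + x * x ^ p * (x - y) := by
          have := sub_nonneg.2 hxy
          gcongr
      _ = _ := by push_cast; ring

theorem sum_Icc_pow_le (n p : ℕ) : ∑ j ∈ Icc 1 n, (j : ℝ) ^ p ≤ n ^ (p + 1) := by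
  calc ∑ j ∈ Icc 1 n, (j : ℝ) ^ p ≤ ∑ _j ∈ Icc 1 n, (n : ℝ) ^ p := by
        refine sum_le_sum fun j hj => ?_
        have := (mem_Icc.1 hj).2
        gcongr
    _ = _ := by simp [pow_succ']

/-- Saturated spots form an upper segment, so each lies within `#D` of `n`; replacing `j ^ p` by `n
^ p` costs at most `p * n ^ p * #D / n` for each of at most `#D` spots. -/
theorem mul_abs_sum_saturatedSpots_sub_le {α : Type*} [Fintype α] (n p : ℕ) (f : α → ℕ) :
    n * |∑ j ∈ saturatedSpots (n + 1) n f, (j : ℝ) ^ p - n ^ p * #(saturatedSpots (n + 1) n f)| ≤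
      p * n ^ p * (#(saturatedSpots n n f) : ℝ) ^ 2 := by
  set B := saturatedSpots (n + 1) n f with hB
  set D := #(saturatedSpots n n f) with hD
  have hsub : B ⊆ saturatedSpots n n f := saturatedSpots_anti (Nat.le_succ n) n f
  have hBD : #B ≤ D := card_le_card hsub
  have hle : ∀ j ∈ B, j ≤ n := fun j hj => (mem_Icc.1 (saturatedSpots_subset_Icc _ _ _ hj)).2
  have h1 : (n : ℝ) ^ p * #B - ∑ j ∈ B, (j : ℝ) ^ p = ∑ j ∈ B, ((n : ℝ) ^ p - j ^ p) := by
    rw [sum_sub_distrib, sum_const, nsmul_eq_mul, mul_comm]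
  have h2 : ∀ j ∈ B, (0 : ℝ) ≤ (n : ℝ) ^ p - j ^ p := by
    intro j hj
    have : (j : ℝ) ≤ n := by exact_mod_cast hle j hj
    have := pow_le_pow_left₀ (Nat.cast_nonneg j) this p
    linarith
  rw [abs_sub_comm, h1, abs_of_nonneg (sum_nonneg h2), mul_sum]
  calc ∑ j ∈ B, (n : ℝ) * ((n : ℝ) ^ p - j ^ p) ≤ ∑ _j ∈ B, p * (n : ℝ) ^ p * D := by
        refine sum_le_sum fun j hj => ?_
        refine (mul_pow_sub_pow_le (Nat.cast_nonneg j) (by exact_mod_cast hle j hj) p).trans ?_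
        have : (n : ℝ) - j ≤ D := by
          rw [← Nat.cast_sub (hle j hj)]
          exact_mod_cast sub_le_card_saturatedSpots (hsub hj)
        gcongr
    _ = #B * (p * (n : ℝ) ^ p * D) := by rw [sum_const, nsmul_eq_mul]
    _ ≤ D * (p * (n : ℝ) ^ p * D) := by gcongr
    _ = _ := by ring

theorem sum_Icc_ite_saturatedSpots {α : Type*} [Fintype α] (s n : ℕ) (f : α → ℕ) (g : ℕ → ℝ) :
    ∑ j ∈ Icc 1 n, (if j ∈ saturatedSpots s n f then 1 else 0) * g j =
      ∑ j ∈ saturatedSpots s n f, g j := by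
  simp only [ite_mul, one_mul, zero_mul]
  rw [sum_ite_mem, inter_eq_right.2 (saturatedSpots_subset_Icc _ _ _)]

theorem abs_sum_two_cars_sub_le {m : ℕ} (n p q : ℕ) (f : Fin m → ℕ) :
    |(∑ l ∈ Icc 1 n, if l ∈ saturatedSpots (n + 1) n f then (0 : ℝ) else ∑ j ∈ Icc 1 n,
        if j ∈ saturatedSpots (n + 1) n (Fin.cons l f : Fin (m + 1) → ℕ) then 0 else
          (j : ℝ) ^ p * (l : ℝ) ^ q) -
      ((∑ j ∈ Icc 1 n, (j : ℝ) ^ p) * (∑ l ∈ Icc 1 n, (l : ℝ) ^ q) -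
        ((∑ l ∈ Icc 1 n, (l : ℝ) ^ q) * n ^ p + (∑ j ∈ Icc 1 n, (j : ℝ) ^ p) * n ^ q) *
          #(saturatedSpots (n + 1) n f))| ≤
      (1 + p + q) * n ^ (p + q) * (#(saturatedSpots n n f) : ℝ) ^ 2 := by
  set B := saturatedSpots (n + 1) n f with hB
  set D := saturatedSpots n n f with hD
  set Sp := ∑ j ∈ Icc 1 n, (j : ℝ) ^ p with hSp
  set Sq := ∑ j ∈ Icc 1 n, (j : ℝ) ^ q with hSq
  -- `u` is the true indicator that both cars fit, `v` its inclusion–exclusion approximation.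
  set u : ℕ → ℕ → ℝ := fun l j => if l ∈ B then (0 : ℝ) else
    if j ∈ saturatedSpots (n + 1) n (Fin.cons l f : Fin (m + 1) → ℕ) then 0 else 1 with hu
  set v : ℕ → ℕ → ℝ := fun l j =>
    1 - (if j ∈ B then 1 else 0) - (if l ∈ B then 1 else 0) with hv
  have h1 : (∑ l ∈ Icc 1 n, if l ∈ B then (0 : ℝ) else ∑ j ∈ Icc 1 n,
        if j ∈ saturatedSpots (n + 1) n (Fin.cons l f : Fin (m + 1) → ℕ) then 0 else
          (j : ℝ) ^ p * (l : ℝ) ^ q) =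
      ∑ l ∈ Icc 1 n, ∑ j ∈ Icc 1 n, u l j * ((j : ℝ) ^ p * (l : ℝ) ^ q) := by
    refine sum_congr rfl fun l _ => ?_
    simp only [hu]
    split_ifs <;> simp
  have h2 : ∑ l ∈ Icc 1 n, ∑ j ∈ Icc 1 n, v l j * ((j : ℝ) ^ p * (l : ℝ) ^ q) =
      Sp * Sq - Sq * (∑ j ∈ B, (j : ℝ) ^ p) - Sp * ∑ l ∈ B, (l : ℝ) ^ q := by
    rw [hB, ← sum_Icc_ite_saturatedSpots, ← sum_Icc_ite_saturatedSpots, ← hB, mul_comm Sp Sq,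
      mul_comm Sp, hSp, hSq, sum_mul_sum, sum_mul_sum, sum_mul_sum, ← sum_sub_distrib,
      ← sum_sub_distrib]
    refine sum_congr rfl fun l _ => ?_
    rw [← sum_sub_distrib, ← sum_sub_distrib]
    refine sum_congr rfl fun j _ => ?_
    simp only [hv]
    ring
  have h3 : |∑ l ∈ Icc 1 n, ∑ j ∈ Icc 1 n, u l j * ((j : ℝ) ^ p * (l : ℝ) ^ q) -
      ∑ l ∈ Icc 1 n, ∑ j ∈ Icc 1 n, v l j * ((j : ℝ) ^ p * (l : ℝ) ^ q)| ≤
      n ^ (p + q) * (#D : ℝ) ^ 2 := by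
    simp only [← sum_sub_distrib, ← sub_mul]
    calc _ ≤ ∑ l ∈ Icc 1 n, ∑ j ∈ Icc 1 n, |(u l j - v l j) * ((j : ℝ) ^ p * (l : ℝ) ^ q)| :=
          (abs_sum_le_sum_abs _ _).trans (sum_le_sum fun l _ => abs_sum_le_sum_abs _ _)
      _ ≤ ∑ l ∈ Icc 1 n, ∑ j ∈ Icc 1 n, ((if j ∈ D then 1 else 0) * (if l ∈ D then 1 else 0)) *
            (n : ℝ) ^ (p + q) := by
          refine sum_le_sum fun l hl => sum_le_sum fun j hj => ?_
          have hj' := (mem_Icc.1 hj).2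
          have hl' := (mem_Icc.1 hl).2
          rw [abs_mul, abs_of_nonneg (by positivity : (0 : ℝ) ≤ (j : ℝ) ^ p * (l : ℝ) ^ q), pow_add]
          refine mul_le_mul (abs_two_cars_sub_le hj hl) (by gcongr) (by positivity) ?_
          split_ifs <;> simp
      _ = _ := by
          simp only [mul_assoc]
          simp only [sum_Icc_ite_saturatedSpots, hD, sum_const, ← smul_sum]
          simp only [nsmul_eq_mul]
          ring
  have hSp' : |Sp| ≤ n ^ (p + 1) := by
    rw [abs_of_nonneg (by positivity)]
    exact sum_Icc_pow_le n p
  have hSq' : |Sq| ≤ n ^ (q + 1) := by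
    rw [abs_of_nonneg (by positivity)]
    exact sum_Icc_pow_le n q
  have h4 : |Sq * (∑ j ∈ B, (j : ℝ) ^ p - n ^ p * #B)| ≤ p * n ^ (p + q) * (#D : ℝ) ^ 2 := by
    rw [abs_mul]
    calc _ ≤ n ^ (q + 1) * |∑ j ∈ B, (j : ℝ) ^ p - n ^ p * #B| := by gcongr
      _ = n ^ q * (n * |∑ j ∈ B, (j : ℝ) ^ p - n ^ p * #B|) := by ring
      _ ≤ n ^ q * (p * n ^ p * (#D : ℝ) ^ 2) := by
          exact mul_le_mul_of_nonneg_left (mul_abs_sum_saturatedSpots_sub_le n p f) (by positivity)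
      _ = _ := by ring
  have h5 : |Sp * (∑ j ∈ B, (j : ℝ) ^ q - n ^ q * #B)| ≤ q * n ^ (p + q) * (#D : ℝ) ^ 2 := by
    rw [abs_mul]
    calc _ ≤ n ^ (p + 1) * |∑ j ∈ B, (j : ℝ) ^ q - n ^ q * #B| := by gcongr
      _ = n ^ p * (n * |∑ j ∈ B, (j : ℝ) ^ q - n ^ q * #B|) := by ring
      _ ≤ n ^ p * (q * n ^ q * (#D : ℝ) ^ 2) := by
          exact mul_le_mul_of_nonneg_left (mul_abs_sum_saturatedSpots_sub_le n q f) (by positivity)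
      _ = _ := by ring
  rw [h1]
  rw [h2] at h3
  rw [abs_le] at h3 h4 h5 ⊢
  constructor <;> linarith [h3.1, h3.2, h4.1, h4.2, h5.1, h5.2]

theorem sum_boundedTails_add_two (m n p q : ℕ) :
    ∑ π ∈ boundedTails (Fin (m + 2)) n, (π 0 : ℝ) ^ p * (π 1 : ℝ) ^ q =
      ∑ f ∈ boundedTails (Fin m) n, ∑ l ∈ Icc 1 n,
        if l ∈ saturatedSpots (n + 1) n f then (0 : ℝ) else ∑ j ∈ Icc 1 n,
          if j ∈ saturatedSpots (n + 1) n (Fin.cons l f : Fin (m + 1) → ℕ) then 0 else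
            (j : ℝ) ^ p * (l : ℝ) ^ q := by
  rw [sum_boundedTails_succ, sum_boundedTails_succ]
  rfl

/-- A positive proportion of all lists park, so error bounds in units of `n ^ m` become bounds
relative to the count. -/
theorem mul_pow_le_card_boundedTails {c : ℝ} (hc0 : 0 < c) (hc1 : c < 1) {m n : ℕ}
    (hm : (m : ℝ) ≤ c * n) (hmn : m ≤ n) : (1 - c) * (n : ℝ) ^ m ≤ #(boundedTails (Fin m) n) := by
  have h := card_boundedTails n (Fin m) (by simpa using hmn.trans (Nat.le_succ n))
  rw [Fintype.card_fin] at h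
  have hn : (0 : ℝ) < n + 1 := by positivity
  refine le_of_mul_le_mul_right ?_ hn
  rw [h]
  have hc : 0 ≤ 1 - c := by linarith
  calc (1 - c) * (n : ℝ) ^ m * (n + 1) = ((1 - c) * (n + 1)) * (n : ℝ) ^ m := by ring
    _ ≤ ((1 - c) * (n + 1)) * ((n : ℝ) + 1) ^ m := by
        gcongr
        linarith
    _ ≤ _ := by
        gcongr ?_ * _
        linarith

theorem exists_abs_sum_moments_sub_le {c : ℝ} (hc0 : 0 < c) (hc1 : c < 1) (p q : ℕ) :
    ∃ K : ℝ, 0 ≤ K ∧ ∀ m n : ℕ, (m : ℝ) ≤ c * n → m ≤ n →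
      |∑ π ∈ boundedTails (Fin (m + 2)) n, (π 0 : ℝ) ^ p * (π 1 : ℝ) ^ q -
        ((∑ j ∈ Icc 1 n, (j : ℝ) ^ p) * (∑ l ∈ Icc 1 n, (l : ℝ) ^ q) *
            #(boundedTails (Fin m) n) -
          ((∑ l ∈ Icc 1 n, (l : ℝ) ^ q) * n ^ p + (∑ j ∈ Icc 1 n, (j : ℝ) ^ p) * n ^ q) *
            (n * #(boundedTails (Fin m) n) - #(boundedTails (Fin (m + 1)) n)))| ≤
        K * n ^ (p + q) * #(boundedTails (Fin m) n) := by
  obtain ⟨K, hK0, hK⟩ := exists_sum_card_saturatedSpots_sq_le hc0 hc1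
  have hc : 0 < 1 - c := by linarith
  refine ⟨(1 + p + q) * (K / (1 - c)), by positivity, fun m n hm hmn => ?_⟩
  have hconst : ∀ x : ℝ, x * #(boundedTails (Fin m) n) = ∑ _f ∈ boundedTails (Fin m) n, x := by
    intro x
    rw [sum_const, nsmul_eq_mul, mul_comm]
  rw [← sum_card_saturatedSpots, sum_boundedTails_add_two, hconst (_ * _), mul_sum (boundedTails _ _),
    ← sum_sub_distrib, ← sum_sub_distrib]
  calc _ ≤ ∑ f ∈ boundedTails (Fin m) n,
        (1 + p + q) * (n : ℝ) ^ (p + q) * (#(saturatedSpots n n f) : ℝ) ^ 2 :=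
        (abs_sum_le_sum_abs _ _).trans (sum_le_sum fun f _ => abs_sum_two_cars_sub_le n p q f)
    _ ≤ (1 + p + q) * (n : ℝ) ^ (p + q) * (K * n ^ m) := by
        rw [← mul_sum]
        gcongr
        exact hK m n hm
    _ = (1 + p + q) * (K / (1 - c)) * (n : ℝ) ^ (p + q) * ((1 - c) * n ^ m) := by
        field_simp
    _ ≤ _ := by
        gcongr
        exact mul_pow_le_card_boundedTails hc0 hc1 hm hmn

end Moments

/-! ### First-order expansions in 1/n -/

section Expansions
open Finset Filter Asymptotics

/-- `u n = a + b / n + O(1 / n ^ 2)` as `n → ∞`. -/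
def HasExpansion (u : ℕ → ℝ) (a b : ℝ) : Prop :=
  (fun n : ℕ => u n - a - b / n) =O[atTop] fun n : ℕ => 1 / (n : ℝ) ^ 2

theorem isBigO_inv_natCast_one : (fun n : ℕ => 1 / (n : ℝ)) =O[atTop] fun _ => (1 : ℝ) :=
  tendsto_one_div_atTop_nhds_zero_nat.isBigO_one ℝ

theorem isBigO_inv_natCast_sq_one :
    (fun n : ℕ => 1 / (n : ℝ) ^ 2) =O[atTop] fun _ => (1 : ℝ) := by
  simpa [pow_two] using isBigO_inv_natCast_one.mul isBigO_inv_natCast_one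

theorem isBigO_add_div_natCast_one (a b : ℝ) :
    (fun n : ℕ => a + b / (n : ℝ)) =O[atTop] fun _ => (1 : ℝ) := by
  refine (isBigO_const_const a one_ne_zero _).add ?_
  simpa [div_eq_mul_inv] using isBigO_inv_natCast_one.const_mul_left b

namespace HasExpansion
variable {u v : ℕ → ℝ} {a b a' b' : ℝ}

theorem isBigO_one (hu : HasExpansion u a b) : u =O[atTop] fun _ => (1 : ℝ) := by
  refine ((hu.trans isBigO_inv_natCast_sq_one).add (isBigO_add_div_natCast_one a b)).congr_left
    fun n => ?_
  ring

theorem sub (hu : HasExpansion u a b) (hv : HasExpansion v a' b') :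
    HasExpansion (fun n => u n - v n) (a - a') (b - b') := by
  refine (IsBigO.sub hu hv).congr_left fun n => ?_
  ring

theorem mul (hu : HasExpansion u a b) (hv : HasExpansion v a' b') :
    HasExpansion (fun n => u n * v n) (a * a') (a * b' + b * a') := by
  have h1 : (fun n : ℕ => (u n - a - b / n) * v n) =O[atTop] fun n : ℕ => 1 / (n : ℝ) ^ 2 := by
    simpa using IsBigO.mul hu hv.isBigO_one
  have h2 : (fun n : ℕ => (a + b / n) * (v n - a' - b' / n)) =O[atTop]
      fun n : ℕ => 1 / (n : ℝ) ^ 2 := by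
    simpa using IsBigO.mul (isBigO_add_div_natCast_one a b) hv
  have h3 : (fun n : ℕ => (b * b') * (1 / (n : ℝ) ^ 2)) =O[atTop]
      fun n : ℕ => 1 / (n : ℝ) ^ 2 := (isBigO_refl _ _).const_mul_left _
  refine ((h1.add h2).add h3).congr_left fun n => ?_
  ring

theorem const_mul (k : ℝ) (hu : HasExpansion u a b) :
    HasExpansion (fun n => k * u n) (k * a) (k * b) := by
  refine (IsBigO.const_mul_left hu k).congr_left fun n => ?_
  ring

theorem div_natCast (hu : HasExpansion u a b) : HasExpansion (fun n => u n / n) 0 a := by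
  have h1 : (fun n : ℕ => (u n - a - b / n) * (1 / (n : ℝ))) =O[atTop]
      fun n : ℕ => 1 / (n : ℝ) ^ 2 := by
    simpa using IsBigO.mul hu isBigO_inv_natCast_one
  have h3 : (fun n : ℕ => b * (1 / (n : ℝ) ^ 2)) =O[atTop]
      fun n : ℕ => 1 / (n : ℝ) ^ 2 := (isBigO_refl _ _).const_mul_left _
  refine (h1.add h3).congr_left fun n => ?_
  ring

theorem congr_coeff (hu : HasExpansion u a b) (ha : a = a') (hb : b = b') :
    HasExpansion u a' b' := ha ▸ hb ▸ hu

theorem exists_bound (hu : HasExpansion u a b) :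
    ∃ (C : ℝ) (N : ℕ), ∀ n : ℕ, N ≤ n → |u n - a - b / n| ≤ C / (n : ℝ) ^ 2 := by
  obtain ⟨C, hC⟩ := IsBigO.bound hu
  obtain ⟨N, hN⟩ := eventually_atTop.1 hC
  refine ⟨C, N, fun n hn => ?_⟩
  have := hN n hn
  rwa [Real.norm_eq_abs, Real.norm_of_nonneg (by positivity), mul_one_div] at this

end HasExpansion

theorem hasExpansion_linear_div_linear (α β : ℝ) {γ δ : ℝ} (hγ : 0 < γ) (hδ : 0 ≤ δ) :
    HasExpansion (fun n => (α * n + β) / (γ * n + δ)) (α / γ) ((β * γ - α * δ) / γ ^ 2) := by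
  refine IsBigO.of_bound (|δ * (β * γ - α * δ)| / γ ^ 3) ?_
  filter_upwards [eventually_ge_atTop 1] with n hn
  have hn' : (0 : ℝ) < n := by exact_mod_cast hn
  have hd : 0 < γ * n + δ := by positivity
  have h : (α * n + β) / (γ * n + δ) - α / γ - (β * γ - α * δ) / γ ^ 2 / n =
      -(δ * (β * γ - α * δ)) / (γ ^ 2 * n * (γ * n + δ)) := by
    field_simp
    ring
  rw [h, norm_div, norm_neg, Real.norm_eq_abs, Real.norm_of_nonneg (by positivity),
    Real.norm_of_nonneg (by positivity), div_mul_div_comm, mul_one]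
  refine div_le_div_of_nonneg_left (abs_nonneg _) (by positivity) ?_
  calc γ ^ 3 * (n : ℝ) ^ 2 = γ ^ 2 * n * (γ * n) := by ring
    _ ≤ γ ^ 2 * n * (γ * n + δ) := by
        gcongr
        linarith

theorem sum_Icc_pow_faulhaber (n p : ℕ) : ∑ j ∈ Icc 1 n, (j : ℝ) ^ p =
    ∑ i ∈ range (p + 1), (bernoulli' i : ℝ) * (p + 1).choose i * (n : ℝ) ^ (p + 1 - i) / (p + 1) := by
  have h := sum_Ico_pow n p
  have h2 : Ico 1 (n + 1) = Icc 1 n := by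
    ext
    simp only [mem_Ico, mem_Icc]
    omega
  rw [h2] at h
  exact_mod_cast congrArg (fun x : ℚ => (x : ℝ)) h

/-- In Faulhaber's formula the terms `i = 0` and `i = 1` give 1 and `(p + 1) / 2`, as `bernoulli' 1
= 1 / 2`; later terms are O(1/n²). For `p = 0` there is no term `i = 1`. -/
theorem hasExpansion_sum_pow {p : ℕ} (hp : 1 ≤ p) :
    HasExpansion (fun n => (p + 1) * (∑ j ∈ Icc 1 n, (j : ℝ) ^ p) / n ^ (p + 1)) 1
      ((p + 1) / 2) := by
  obtain ⟨p, rfl⟩ := Nat.exists_eq_add_of_le' hp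
  have hO : ∀ i ∈ range p, (fun n : ℕ =>
      ((bernoulli' (i + 2) : ℝ) * (p + 2).choose (i + 2)) * (1 / (n : ℝ) ^ (i + 2))) =O[atTop]
      fun n : ℕ => 1 / (n : ℝ) ^ 2 := by
    intro i _
    refine IsBigO.const_mul_left (IsBigO.of_bound 1 ?_) _
    filter_upwards [eventually_ge_atTop 1] with n hn
    have hn' : (1 : ℝ) ≤ n := by exact_mod_cast hn
    rw [Real.norm_of_nonneg (by positivity), Real.norm_of_nonneg (by positivity), one_mul]
    exact one_div_le_one_div_of_le (by positivity) (pow_le_pow_right₀ hn' (Nat.le_add_left 2 i))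
  refine (IsBigO.sum hO).congr' ?_ EventuallyEq.rfl
  filter_upwards [eventually_ge_atTop 1] with n hn
  have hn' : (0 : ℝ) < n := by exact_mod_cast hn
  have hp' : ((p + 1 : ℕ) : ℝ) + 1 ≠ 0 := by positivity
  rw [sum_Icc_pow_faulhaber, ← sum_div, mul_div_cancel₀ _ hp', sum_range_succ', sum_range_succ',
    add_div, add_div, sum_div]
  have hterm : ∀ i ∈ range p, (bernoulli' (i + 1 + 1) : ℝ) * (p + 1 + 1).choose (i + 1 + 1) *
      (n : ℝ) ^ (p + 1 + 1 - (i + 1 + 1)) / n ^ (p + 1 + 1) =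
      ((bernoulli' (i + 2) : ℝ) * (p + 2).choose (i + 2)) * (1 / (n : ℝ) ^ (i + 2)) := by
    intro i hi
    rw [mem_range] at hi
    have hpow : (n : ℝ) ^ (p + 1 + 1 - (i + 1 + 1)) / n ^ (p + 1 + 1) = 1 / (n : ℝ) ^ (i + 2) := by
      rw [div_eq_div_iff (by positivity) (by positivity), one_mul, ← pow_add]
      congr 1
      omega
    rw [mul_div_assoc, hpow]
  rw [sum_congr rfl hterm]
  simp only [Finset.sum_apply]
  have h1 : (n : ℝ) ^ (p + 2) = n ^ (p + 1) * n := pow_succ _ _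
  simp only [zero_add, bernoulli'_zero, bernoulli'_one, Nat.choose_zero_right, Nat.choose_one_right,
    Nat.sub_zero, Nat.add_sub_cancel, Rat.cast_one, Nat.cast_one, one_mul]
  rw [div_self (by positivity)]
  push_cast
  field_simp
  ring

theorem hasExpansion_sum_one :
    HasExpansion (fun n => ((0 : ℕ) + 1) * (∑ j ∈ Icc 1 n, (j : ℝ) ^ 0) / n ^ (0 + 1)) 1 0 := by
  refine (isBigO_zero _ _).congr' ?_ EventuallyEq.rfl
  filter_upwards [eventually_ge_atTop 1] with n hn
  have hn' : (n : ℝ) ≠ 0 := by exact_mod_cast (by omega : n ≠ 0)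
  simp [hn']

/-! ### Assembling the two-car moment -/

theorem card_boundedTails_ratios {c : ℝ} (hc1 : c < 1) {m n : ℕ} (hmn : (m : ℝ) + 2 = c * n)
    (hn : 1 ≤ n) :
    0 < (#(boundedTails (Fin m) n) : ℝ) ∧ 0 < (#(boundedTails (Fin (m + 2)) n) : ℝ) ∧
      (n * #(boundedTails (Fin m) n) - #(boundedTails (Fin (m + 1)) n) : ℝ) =
        (c * n + -2) / ((1 - c) * n + 3) * #(boundedTails (Fin m) n) ∧
      (n : ℝ) ^ 2 * #(boundedTails (Fin m) n) =
        ((1 - c) * n + 3) / ((1 - c) * n + 1) * ((1 * n + 0) / (1 * n + 1)) ^ 2 *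
          #(boundedTails (Fin (m + 2)) n) := by
  have hn0 : (0 : ℝ) < n := by exact_mod_cast hn
  have hc : 0 < 1 - c := by linarith
  have hlt : m + 2 ≤ n := by
    have : ((m + 2 : ℕ) : ℝ) ≤ n := by
      push_cast
      nlinarith
    exact_mod_cast this
  have h0 := card_boundedTails n (Fin m) (by simp; omega)
  have h1 := card_boundedTails n (Fin (m + 1)) (by simp; omega)
  have h2 := card_boundedTails n (Fin (m + 2)) (by simp; omega)
  simp only [Fintype.card_fin, Nat.cast_add, Nat.cast_one, Nat.cast_ofNat] at h0 h1 h2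
  have hm : (m : ℝ) = c * n - 2 := by linarith
  have hd : 0 < (1 - c) * n := by positivity
  rw [show (n : ℝ) + 1 - m = (1 - c) * n + 3 by rw [hm]; ring] at h0
  rw [show (n : ℝ) + 1 - (m + 1) = (1 - c) * n + 2 by rw [hm]; ring] at h1
  rw [show (n : ℝ) + 1 - (m + 2) = (1 - c) * n + 1 by rw [hm]; ring] at h2
  generalize (#(boundedTails (Fin m) n) : ℝ) = A0 at *
  generalize (#(boundedTails (Fin (m + 1)) n) : ℝ) = A1 at *
  generalize (#(boundedTails (Fin (m + 2)) n) : ℝ) = A2 at *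
  have hn1 : (0 : ℝ) < (n : ℝ) + 1 := by positivity
  have hP : 0 < ((n : ℝ) + 1) ^ m := by positivity
  rw [pow_succ] at h1
  rw [pow_add] at h2
  generalize ((n : ℝ) + 1) ^ m = P at *
  have e0 : A0 = ((1 - c) * n + 3) * P / (n + 1) := by
    rw [eq_div_iff hn1.ne']
    exact h0
  have e1 : A1 = ((1 - c) * n + 2) * P := mul_right_cancel₀ hn1.ne' (by linarith)
  have e2 : A2 = ((1 - c) * n + 1) * P * (n + 1) := mul_right_cancel₀ hn1.ne' (by linarith)
  generalize hD : (1 - c) * (n : ℝ) = d at *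
  have hcn : c * (n : ℝ) = n - d := by rw [← hD]; ring
  subst e0 e1 e2
  refine ⟨by positivity, by positivity, ?_, ?_⟩
  · rw [hcn]
    field_simp
    ring
  · field_simp
    ring

theorem exists_two_car_moment_expansion {c : ℝ} (hc0 : 0 < c) (hc1 : c < 1) {p q : ℕ} {s t : ℝ}
    (hp : HasExpansion (fun n => (p + 1) * (∑ j ∈ Icc 1 n, (j : ℝ) ^ p) / n ^ (p + 1)) 1 s)
    (hq : HasExpansion (fun n => (q + 1) * (∑ j ∈ Icc 1 n, (j : ℝ) ^ q) / n ^ (q + 1)) 1 t) :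
    ∃ (C : ℝ) (N : ℕ), ∀ m n : ℕ, N ≤ n → (m : ℝ) + 2 = c * n →
      ∃ r : ℝ, |r| ≤ C / (n : ℝ) ^ 2 ∧
        parkingMean (m + 2) n (fun π => (π 0 : ℝ) ^ p * (π 1 : ℝ) ^ q) =
          (n : ℝ) ^ (p + q) / (((p : ℝ) + 1) * ((q : ℝ) + 1)) *
            (1 + 1 / (n : ℝ) * (s + t - c * ((p : ℝ) + q) / (1 - c)) + r) := by
  have hc : 0 < 1 - c := by linarith
  obtain ⟨K, hK0, hK⟩ := exists_abs_sum_moments_sub_le hc0 hc1 p q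
  have hl := (hasExpansion_linear_div_linear c (-2) hc (by norm_num : (0 : ℝ) ≤ 3)).div_natCast
  have hR1 := hasExpansion_linear_div_linear (1 - c) 3 hc zero_le_one
  have hR2 := hasExpansion_linear_div_linear 1 0 zero_lt_one zero_le_one
  have hR := hR1.mul (hR2.mul hR2)
  have hmain := hR.mul (((hp.mul hq).sub ((hq.mul hl).const_mul (p + 1))).sub
    ((hp.mul hl).const_mul (q + 1)))
  -- The count ratio has 1/n coefficient `2 / (1 - c) - 2 = 2 * c / (1 - c)`, which turns `-(p + 1)
  -- - (q + 1)` into `-(p + q)` as the multiplier of `c / (1 - c)`.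
  replace hmain := hmain.congr_coeff (a' := 1) (b' := s + t - c * (p + q) / (1 - c))
    (by field_simp; ring) (by field_simp; ring)
  obtain ⟨C, N, hC⟩ := hmain.exists_bound
  obtain ⟨C', hC'⟩ := hR.isBigO_one.bound
  obtain ⟨N', hN'⟩ := eventually_atTop.1 hC'
  refine ⟨C + C' * ((p + 1) * (q + 1) * K), max (max N N') 1, fun m n hn hmn => ?_⟩
  have hn1 : 1 ≤ n := (le_max_right _ _).trans hn
  have hnN : N ≤ n := (le_max_left _ _).trans ((le_max_left _ _).trans hn)
  have hnN' : N' ≤ n := (le_max_right _ _).trans ((le_max_left _ _).trans hn)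
  have hn0 : (0 : ℝ) < n := by exact_mod_cast hn1
  obtain ⟨hA0, hA2, hL, hQ⟩ := card_boundedTails_ratios hc1 hmn hn1
  have hmle : (m : ℝ) ≤ n := by nlinarith
  have hW := hK m n (by linarith) (by exact_mod_cast hmle)
  have hCn := hC n hnN
  have hRn := hN' n hnN'
  simp only [Real.norm_eq_abs, norm_one, mul_one] at hRn
  rw [hL] at hW
  rw [parkingMean, parkingFunctions_eq_boundedTails, expect_eq_sum_div_card]
  generalize ∑ π ∈ boundedTails (Fin (m + 2)) n, (π 0 : ℝ) ^ p * (π 1 : ℝ) ^ q = W at *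
  generalize (#(boundedTails (Fin m) n) : ℝ) = A0 at *
  generalize (#(boundedTails (Fin (m + 2)) n) : ℝ) = A2 at *
  generalize ∑ j ∈ Icc 1 n, (j : ℝ) ^ p = Sp at *
  generalize ∑ j ∈ Icc 1 n, (j : ℝ) ^ q = Sq at *
  rw [pow_two ((1 * (n : ℝ) + 0) / (1 * n + 1))] at hQ
  generalize ((1 - c) * (n : ℝ) + 3) / ((1 - c) * n + 1) *
    ((1 * n + 0) / (1 * n + 1) * ((1 * n + 0) / (1 * n + 1))) = R at *
  generalize (c * (n : ℝ) + -2) / ((1 - c) * n + 3) = l at *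
  -- `V` is the main term of the moment sum `W`, and `M` the inverse of the leading order of the
  -- mean.
  set V := Sp * Sq * A0 - (Sq * n ^ p + Sp * n ^ q) * (l * A0) with hV
  set M := (((p : ℝ) + 1) * (q + 1)) / n ^ (p + q) with hM
  have hM0 : 0 < M := by positivity
  have hVeq : M * (V / A2) = R * ((p + 1) * Sp / n ^ (p + 1) * ((q + 1) * Sq / n ^ (q + 1)) -
      (p + 1) * ((q + 1) * Sq / n ^ (q + 1) * (l / n)) -
      (q + 1) * ((p + 1) * Sp / n ^ (p + 1) * (l / n))) := by
    have hR' : R = n ^ 2 * A0 / A2 := by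
      rw [eq_div_iff hA2.ne']
      exact hQ.symm
    rw [hR', hV, hM, pow_succ, pow_succ, pow_add]
    field_simp
    ring
  have herr : |M * ((W - V) / A2)| ≤ C' * ((p + 1) * (q + 1) * K) / n ^ 2 := by
    have hRA : A0 / A2 = R / n ^ 2 := by
      rw [div_eq_div_iff hA2.ne' (by positivity)]
      linarith
    have hR0 : 0 ≤ R := by
      have : 0 ≤ R / (n : ℝ) ^ 2 := by
        rw [← hRA]
        positivity
      rwa [le_div_iff₀ (by positivity), zero_mul] at this
    rw [abs_mul, abs_of_pos hM0, abs_div, abs_of_pos hA2]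
    calc M * (|W - V| / A2) ≤ M * (K * n ^ (p + q) * A0 / A2) := by gcongr
      _ = (p + 1) * (q + 1) * K * (A0 / A2) := by
          rw [hM]
          field_simp
      _ = R * ((p + 1) * (q + 1) * K) / n ^ 2 := by
          rw [hRA]
          ring
      _ ≤ _ := by
          gcongr
          exact (le_abs_self R).trans hRn
  refine ⟨M * (W / A2) - 1 - 1 / n * (s + t - c * (p + q) / (1 - c)), ?_, ?_⟩
  · have hsplit : M * (W / A2) = M * (V / A2) + M * ((W - V) / A2) := by ring
    rw [← hVeq] at hCn
    rw [hsplit]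
    rw [abs_le] at hCn herr ⊢
    rw [add_div]
    have h1 : 1 / (n : ℝ) * (s + t - c * (p + q) / (1 - c)) =
        (s + t - c * (p + q) / (1 - c)) / n := by ring
    rw [h1]
    constructor <;> linarith [hCn.1, hCn.2, herr.1, herr.2]
  · rw [hM]
    field_simp
    ring

end Expansions

theorem mainTheorem4 (c : ℝ) (hc0 : 0 < c) (hc1 : c < 1) :
    (∀ p : ℕ, 1 ≤ p →
      ∃ (C : ℝ) (N : ℕ), ∀ (m n : ℕ) (hm : 1 ≤ m), N ≤ n → (m : ℝ) = c * n →
        ∃ r : ℝ, |r| ≤ C / (n : ℝ) ^ 2 ∧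
          parkingMean m n (fun π => (π ⟨0, hm⟩ : ℝ) ^ p) =
            (n : ℝ) ^ p / ((p : ℝ) + 1) *
              (1 + 1 / (n : ℝ) * (((p : ℝ) + 1) / 2 - c * p / (1 - c)) + r)) ∧
    (∀ p q : ℕ, 1 ≤ p → 1 ≤ q →
      ∃ (C : ℝ) (N : ℕ), ∀ (m n : ℕ) (hm : 2 ≤ m), N ≤ n → (m : ℝ) = c * n →
        ∃ r : ℝ, |r| ≤ C / (n : ℝ) ^ 2 ∧
          parkingMean m n
              (fun π => (π ⟨0, by omega⟩ : ℝ) ^ p * (π ⟨1, hm⟩ : ℝ) ^ q) =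
            (n : ℝ) ^ (p + q) / (((p : ℝ) + 1) * ((q : ℝ) + 1)) *
              (1 + 1 / (n : ℝ) * (((p : ℝ) + q + 2) / 2 - c * ((p : ℝ) + q) / (1 - c)) + r)) := by
  refine ⟨fun p hp => ?_, fun p q hp hq => ?_⟩
  · obtain ⟨C, N, h⟩ := exists_two_car_moment_expansion hc0 hc1 (hasExpansion_sum_pow hp)
      hasExpansion_sum_one
    -- The two-car estimate with `q = 0` needs a second car; `n ≥ 2 / c` forces `m ≥ 2`.
    obtain ⟨N', hN'⟩ := exists_nat_ge (2 / c)
    refine ⟨C, max N N', fun m n hm hn hmn => ?_⟩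
    have hm2 : 2 ≤ m := by
      have h1 : (N' : ℝ) ≤ n := by exact_mod_cast (le_max_right _ _).trans hn
      have h2 : (2 : ℝ) ≤ m := by
        rw [hmn, ← div_le_iff₀' hc0]
        exact hN'.trans h1
      exact_mod_cast h2
    obtain ⟨m, rfl⟩ := Nat.exists_eq_add_of_le' hm2
    push_cast at hmn
    obtain ⟨r, hr, hE⟩ := h m n ((le_max_left _ _).trans hn) hmn
    refine ⟨r, hr, ?_⟩
    simpa using hE
  · obtain ⟨C, N, h⟩ := exists_two_car_moment_expansion hc0 hc1 (hasExpansion_sum_pow hp)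
      (hasExpansion_sum_pow hq)
    refine ⟨C, N, fun m n hm hn hmn => ?_⟩
    obtain ⟨m, rfl⟩ := Nat.exists_eq_add_of_le' hm
    push_cast at hmn
    obtain ⟨r, hr, hE⟩ := h m n hn hmn
    refine ⟨r, hr, hE.trans ?_⟩
    ring
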